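/- All graphs are finite and simple. A graph is 2-connected if it is connected, has more than two vertices, and stays connected after deleting any one vertex. A plane graph is a connected graph with at least one edge together with an embedding in the plane, given combinatorially: a cyclic order of the edges at each vertex, whose face-tracing walks (the faces) satisfy Euler's formula $|V|-|E|+|F|=2$, and a distinguished face, the infinite face; the other faces are finite. $E(s)$ denotes the set of edges on the boundary of the face $s$; the boundary of the infinite face is the periphery, vertices on it are exterior, and the plane graph is outerplane if all its vertices are exterior. An adjacent triple of finite faces is a triple $(s,s',s'')$ of three distinct finite faces such that $s,s'$ have a common edge $e$ and $s',s''$ have a common edge $f$; it is linearly connected if the distance $d_{L(G)}(e,f)$ of $e$ and $f$ in the line graph $L(G)$ is odd. A graph with a perfect matching is elementary if the edges that lie in some perfect matching form a connected subgraph. A plane elementary bipartite graph $G\not\cong K_2$ is peripherally 2-colorable if every vertex has degree 2 or 3, all vertices of degree 3 are exterior, and $G$ has a proper black-white coloring of its vertices in which the vertices of degree 3 (if any) alternate between black and white along the clockwise orientation of the periphery. **Lemma 3.3.** Let $G$ be a 2-connected outerplane bipartite graph. Then $G$ is peripherally 2-colorable if and only if $G$ does not have any adjacent triple of finite faces that is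 linearly connected. -/

import Mathlib

/-- A graph is 2-connected if it is connected, has more than two vertices, and stays connected
after the deletion of any single vertex. -/
def SimpleGraph.IsTwoConnected {V : Type*} (G : SimpleGraph V) : Prop :=
  2 < Nat.card V ∧ G.Connected ∧ ∀ v : V, (G.induce {v}ᶜ).Connected

/-- A rotation system: a cyclic order, around each vertex, of the darts (edges directed away from
the vertex). -/
structure RotationSystem {V : Type*} (G : SimpleGraph V) where
  /-- The successor of a dart in the cyclic order around its tail. -/
  rot : Equiv.Perm G.Dart
  /-- `rot` maps a dart to a dart with the same tail. -/
  rot_fst : ∀ d : G.Dart, (rot d).fst = d.fst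
  /-- `rot` permutes the darts with a given tail cyclically. -/
  rot_sameCycle : ∀ d d' : G.Dart, d.fst = d'.fst → rot.SameCycle d d'

namespace RotationSystem

/-- The permutation `d ↦ rot d.symm`: it maps a dart to the next dart on the boundary walk of
its face, by going along `d` and continuing with the dart that follows the reversal of `d` in the
rotation at the head of `d`. -/
def next {V : Type*} {G : SimpleGraph V} (R : RotationSystem G) : Equiv.Perm G.Dart :=
  (Function.Involutive.toPerm _ SimpleGraph.Dart.symm_involutive).trans R.rot

/-- The faces are the orbits of `next` on the darts. -/
def Face {V : Type*} {G : SimpleGraph V} (R : RotationSystem G) : Type _ :=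
  Quotient (Equiv.Perm.SameCycle.setoid R.next)

/-- The face whose boundary walk contains the dart `d`. -/
def faceOf {V : Type*} {G : SimpleGraph V} (R : RotationSystem G) (d : G.Dart) : R.Face :=
  Quotient.mk (Equiv.Perm.SameCycle.setoid R.next) d

end RotationSystem

/-- An embedding of a finite connected graph (with at least one edge) in the plane, given
combinatorially, i.e. up to orientation preserving homeomorphism of the plane: a rotation system
for which the surface obtained by gluing a disc to each facial walk is the sphere (Euler's
formula), together with the choice of the face that contains the point at infinity. -/
structure PlaneEmbedding {V : Type*} [Finite V] (G : SimpleGraph V) extends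
    RotationSystem G where
  /-- The graph is connected. -/
  connected : G.Connected
  /-- Euler's formula `|V| - |E| + |F| = 2`. -/
  euler : Nat.card V + Nat.card toRotationSystem.Face = Nat.card G.edgeSet + 2
  /-- The infinite face. -/
  outerFace : toRotationSystem.Face

namespace PlaneEmbedding

/-- The set `E(s)` of the edges enclosing the face `s`. -/
def faceEdges {V : Type*} [Finite V] {G : SimpleGraph V} (P : PlaneEmbedding G)
    (s : P.Face) : Set G.edgeSet :=
  {e | ∃ d : G.Dart, P.faceOf d = s ∧ d.edge = e}

/-- A vertex is exterior if it lies on the periphery of the graph, that is, if it is an end of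
an edge enclosing the infinite face. -/
def IsExterior {V : Type*} [Finite V] {G : SimpleGraph V} (P : PlaneEmbedding G) (v : V) : Prop :=
  ∃ e ∈ P.faceEdges P.outerFace, v ∈ (e : Sym2 V)

/-- A plane graph is outerplane if all its vertices are exterior. -/
def IsOuterplane {V : Type*} [Finite V] {G : SimpleGraph V} (P : PlaneEmbedding G) : Prop :=
  ∀ v : V, P.IsExterior v

/-- `(s, s', s'')` is an adjacent triple of finite faces, where `e` is a common edge of `s` and
`s'`, and `f` is a common edge of `s'` and `s''`. (In a 2-connected outerplane graph two distinct
finite faces have at most one common edge.) -/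
def IsAdjacentTriple {V : Type*} [Finite V] {G : SimpleGraph V} (P : PlaneEmbedding G)
    (s s' s'' : P.Face) (e f : G.edgeSet) : Prop :=
  (s ≠ P.outerFace ∧ s' ≠ P.outerFace ∧ s'' ≠ P.outerFace) ∧
  (s ≠ s' ∧ s' ≠ s'' ∧ s ≠ s'') ∧
  (e ∈ P.faceEdges s ∧ e ∈ P.faceEdges s') ∧
  (f ∈ P.faceEdges s' ∧ f ∈ P.faceEdges s'')

/-- The plane graph has an adjacent triple of finite faces that is linearly connected, i.e. whose
two common edges have odd distance in the line graph. -/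
def HasLinearlyConnectedTriple {V : Type*} [Finite V] {G : SimpleGraph V}
    (P : PlaneEmbedding G) : Prop :=
  ∃ (s s' s'' : P.Face) (e f : G.edgeSet),
    P.IsAdjacentTriple s s' s'' e f ∧ Odd (G.lineGraph.dist e f)

end PlaneEmbedding

/-- The spanning subgraph formed by the allowed edges, i.e. the edges that are contained in some
perfect matching. -/
def SimpleGraph.allowedGraph {V : Type*} (G : SimpleGraph V) : SimpleGraph V where
  Adj u v := ∃ M : G.Subgraph, M.IsPerfectMatching ∧ M.Adj u v
  symm := ⟨fun _ _ ⟨M, hM, h⟩ => ⟨M, hM, h.symm⟩⟩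
  loopless := ⟨fun _ ⟨M, _, h⟩ => G.irrefl (M.adj_sub h)⟩

/-- A graph is elementary if it has a perfect matching and its allowed edges form a connected
subgraph (which is automatically spanning, as every vertex is covered by a perfect matching). -/
def SimpleGraph.IsElementary {V : Type*} (G : SimpleGraph V) : Prop :=
  (∃ M : G.Subgraph, M.IsPerfectMatching) ∧ G.allowedGraph.Connected

/-- Peripherally 2-colorable plane graphs. In the last clause `P.next` runs along the periphery,
and the clause says that the colors of any two cyclically consecutive vertices of degree 3 on
the periphery are different. -/
def PlaneEmbedding.IsPeripherallyTwoColorable {V : Type*} [Fintype V] {G : SimpleGraph V}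
    [DecidableRel G.Adj] (P : PlaneEmbedding G) : Prop :=
  G.IsBipartite ∧ G.IsElementary ∧ ¬ Nonempty (G ≃g (⊤ : SimpleGraph (Fin 2))) ∧
  (∀ v : V, G.degree v = 2 ∨ G.degree v = 3) ∧
  (∀ v : V, G.degree v = 3 → P.IsExterior v) ∧
  ∃ C : G.Coloring Bool, ∀ (d : G.Dart) (n : ℕ), P.faceOf d = P.outerFace → 0 < n →
    G.degree d.fst = 3 → G.degree ((P.next ^ n) d).fst = 3 →
    (∀ m : ℕ, 0 < m → m < n → G.degree ((P.next ^ m) d).fst ≠ 3) →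
    C d.fst ≠ C ((P.next ^ n) d).fst

/-! Call an edge with finite faces on both sides a chord, and direct the edges of a finite face
along its boundary walk. Two edges of such a face have odd distance in the line graph exactly when
their tails differ in color (`odd_lineGraph_dist_iff`): a shortest path between them cannot run from
tail to tail or from head to head, since by planarity it would meet another end of the two edges and
could be shortened. So it joins a tail to a head, and colors give the parity of its length, which is
one less than the distance. As two finite faces share at most one edge, having no linearly connected
triple means that the chords of each finite face all have tails of one color
(`not_hasLinearlyConnectedTriple_iff`).

This condition bounds the degrees by 3, since two neighboring chords at a vertex would be traversed
by a common face, one inwards and one outwards. When all degrees are 2 or 3, the stretch of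
periphery between consecutive vertices of degree 3 borders a single finite face, whose boundary
comes in by one chord and leaves by another; equal colors of the chord tails amount to different
colors at the ends of the stretch. Elementarity is automatic: the periphery is a Hamiltonian cycle
of even length, the union of two perfect matchings.

The Jordan curve theorem enters in mod 2 form. By Euler's formula every closed walk is a sum of face
boundaries (`exists_faceLabel`), so the faces carry labels in `ZMod 2` that change exactly across
the edges passed an odd number of times. -/

/-! ### Incidence matrices and chains modulo 2 -/

namespace SimpleGraph

/-- The matrix whose `(e, x)` entry counts, modulo 2, the darts `d` of the edge `e` that are
labelled `g d = x`. -/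
def dartMatrix {V X : Type*} [Fintype V] [DecidableEq V] {G : SimpleGraph V}
    [DecidableRel G.Adj] [DecidableEq X] (g : G.Dart → X) : Matrix G.edgeSet X (ZMod 2) :=
  fun e x => ∑ d : G.Dart, if d.edge = e ∧ g d = x then 1 else 0

section DartMatrix

variable {V X : Type*} [Fintype V] [DecidableEq V] {G : SimpleGraph V} [DecidableRel G.Adj]
  [DecidableEq X] (g : G.Dart → X)

theorem dartMatrix_mulVec [Fintype X] (c : X → ZMod 2) (d : G.Dart) :
    (dartMatrix g).mulVec c ⟨d.edge, d.edge_mem⟩ = c (g d) + c (g d.symm) := by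
  have h1 : (dartMatrix g).mulVec c ⟨d.edge, d.edge_mem⟩
      = ∑ d' : G.Dart, if d'.edge = d.edge then c (g d') else 0 := by
    simp only [Matrix.mulVec, dotProduct, dartMatrix, Finset.sum_mul]
    rw [Finset.sum_comm]
    refine Finset.sum_congr rfl fun d' _ => ?_
    by_cases h : d'.edge = d.edge <;> simp [h]
  rw [h1, ← Finset.sum_filter]
  have h2 : (Finset.univ.filter fun d' : G.Dart => d'.edge = d.edge) = {d, d.symm} := by
    ext d'
    simp [dart_edge_eq_iff]
  rw [h2, Finset.sum_pair d.symm_ne.symm]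

theorem dartMatrix_transpose_mulVec (z : G.edgeSet → ZMod 2) (x : X) :
    (dartMatrix g).transpose.mulVec z x
      = ∑ d : G.Dart with g d = x, z ⟨d.edge, d.edge_mem⟩ := by
  simp only [Matrix.mulVec, dotProduct, dartMatrix, Matrix.transpose_apply, Finset.sum_mul]
  rw [Finset.sum_comm, Finset.sum_filter]
  refine Finset.sum_congr rfl fun d _ => ?_
  rw [Finset.sum_eq_single (⟨d.edge, d.edge_mem⟩ : G.edgeSet)]
  · simp
  · intro e _ he
    rw [if_neg, zero_mul]
    rintro ⟨h, -⟩
    exact he (Subtype.ext h.symm)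
  · simp

/-- The kernel consists of the labellings that agree at both darts of every edge. By hypothesis
these are constant, so the nullity is at most 1. This serves for vertices (`g` the tail) and for
faces (`g` the face of a dart). -/
theorem card_le_rank_dartMatrix_add_one [Fintype X]
    (h : ∀ c : X → ZMod 2, (∀ d : G.Dart, c (g d) = c (g d.symm)) → ∀ x y, c x = c y) :
    Fintype.card X ≤ (dartMatrix g).rank + 1 := by
  have h1 := LinearMap.finrank_range_add_finrank_ker (dartMatrix g).mulVecLin
  have h2 : LinearMap.ker (dartMatrix g).mulVecLin ≤ Submodule.span (ZMod 2) {fun _ : X => 1} := by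
    intro c hc
    rw [LinearMap.mem_ker, Matrix.mulVecLin_apply] at hc
    have hconst : ∀ x y, c x = c y := by
      refine h c fun d => ?_
      have := congrFun hc ⟨d.edge, d.edge_mem⟩
      rw [dartMatrix_mulVec] at this
      exact (CharTwo.add_eq_zero).1 this
    rw [Submodule.mem_span_singleton]
    rcases isEmpty_or_nonempty X with hX | ⟨⟨x⟩⟩
    · exact ⟨0, Subsingleton.elim _ _⟩
    · exact ⟨c x, funext fun y => by simp [hconst x y]⟩
  have h3 := (Submodule.finrank_mono h2).trans (finrank_span_le_card _)
  rw [Set.toFinset_singleton, Finset.card_singleton] at h3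
  rw [Module.finrank_fintype_fun_eq_card] at h1
  rw [Matrix.rank]
  omega

end DartMatrix

namespace Walk

variable {V : Type*} [DecidableEq V] {G : SimpleGraph V}

/-- The number of passages of a walk through an edge, modulo 2. -/
def chain {a b : V} (p : G.Walk a b) (e : Sym2 V) : ZMod 2 := p.edges.count e

@[simp] theorem chain_nil {a : V} (e : Sym2 V) : (nil : G.Walk a a).chain e = 0 := by
  simp [chain]

@[simp] theorem chain_cons {a b c : V} (h : G.Adj a b) (p : G.Walk b c) (e : Sym2 V) :
    (cons h p).chain e = p.chain e + if s(a, b) = e then 1 else 0 := by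
  simp [chain, List.count_cons]

@[simp] theorem chain_append {a b c : V} (p : G.Walk a b) (q : G.Walk b c) (e : Sym2 V) :
    (p.append q).chain e = p.chain e + q.chain e := by
  simp [chain, List.count_append]

@[simp] theorem chain_reverse {a b : V} (p : G.Walk a b) (e : Sym2 V) :
    p.reverse.chain e = p.chain e := by
  simp [chain]

theorem chain_eq_zero_of_notMem_support {a b v : V} (p : G.Walk a b) (hv : v ∉ p.support)
    {e : Sym2 V} (he : v ∈ e) : p.chain e = 0 := by
  have : e ∉ p.edges := fun h => hv (p.mem_support_of_mem_edges h he)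
  simp [chain, List.count_eq_zero_of_not_mem this]

/-- The mod 2 boundary of a walk is the sum of its two ends; in particular closed walks are cycles.
-/
theorem sum_chain [Fintype V] [DecidableRel G.Adj] {a b : V} (p : G.Walk a b) (v : V) :
    ∑ d : G.Dart with d.fst = v, p.chain d.edge
      = (if a = v then 1 else 0) + if b = v then 1 else 0 := by
  induction p with
  | nil => simp [CharTwo.add_self_eq_zero]
  | @cons a b c h p ih =>
    simp only [chain_cons, Finset.sum_add_distrib, ih]
    have h1 : ∑ d : G.Dart with d.fst = v, (if s(a, b) = d.edge then (1 : ZMod 2) else 0)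
        = (if a = v then 1 else 0) + if b = v then 1 else 0 := by
      rw [Finset.sum_filter]
      have h2 : ∀ d : G.Dart, (if d.fst = v then if s(a, b) = d.edge then (1 : ZMod 2) else 0
          else 0) = if d.edge = s(a, b) then (if d.fst = v then 1 else 0) else 0 := by
        intro d
        by_cases h3 : d.fst = v <;> by_cases h4 : s(a, b) = d.edge <;> simp [h3, h4, eq_comm]
      simp only [h2]
      rw [← Finset.sum_filter]
      have h3 : (Finset.univ.filter fun d' : G.Dart => d'.edge = s(a, b))
          = {⟨(a, b), h⟩, (⟨(a, b), h⟩ : G.Dart).symm} := by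
        ext d'
        have := dart_edge_eq_iff d' ⟨(a, b), h⟩
        simpa using this
      rw [h3, Finset.sum_pair (Dart.symm_ne _).symm]
      rfl
    rw [h1]
    generalize (if b = v then (1 : ZMod 2) else 0) = x
    generalize (if a = v then (1 : ZMod 2) else 0) = y
    generalize (if c = v then (1 : ZMod 2) else 0) = w
    have := CharTwo.add_self_eq_zero x
    linear_combination this

end Walk

end SimpleGraph

/-! ### Orbits of rotation and face tracing -/

namespace RotationSystem

variable {V : Type*} {G : SimpleGraph V} (R : RotationSystem G)

theorem rot_pow_fst (d : G.Dart) (n : ℕ) : ((R.rot ^ n) d).fst = d.fst := by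
  induction n with
  | zero => rfl
  | succ n ih => rw [pow_succ', Equiv.Perm.mul_apply, R.rot_fst, ih]

theorem next_apply (d : G.Dart) : R.next d = R.rot d.symm := rfl

theorem next_fst (d : G.Dart) : (R.next d).fst = d.snd := R.rot_fst d.symm

theorem faceOf_eq_iff {d d' : G.Dart} : R.faceOf d = R.faceOf d' ↔ R.next.SameCycle d d' :=
  Quotient.eq (r := Equiv.Perm.SameCycle.setoid R.next)

theorem faceOf_next (d : G.Dart) : R.faceOf (R.next d) = R.faceOf d :=
  R.faceOf_eq_iff.2 (Equiv.Perm.sameCycle_apply_left.2 (Equiv.Perm.SameCycle.refl _ _))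

theorem faceOf_next_pow (n : ℕ) (d : G.Dart) : R.faceOf ((R.next ^ n) d) = R.faceOf d :=
  R.faceOf_eq_iff.2 (Equiv.Perm.sameCycle_pow_left.2 (Equiv.Perm.SameCycle.refl _ _))

theorem faceOf_rot (d : G.Dart) : R.faceOf (R.rot d) = R.faceOf d.symm := by
  rw [← R.faceOf_next d.symm, next_apply, SimpleGraph.Dart.symm_symm]

theorem exists_faceOf_eq (s : R.Face) : ∃ d, R.faceOf d = s := Quotient.exists_rep s

instance [Finite V] : Finite R.Face := by
  classical
  have := Fintype.ofFinite V
  exact Quotient.finite _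

theorem exists_rot_pow_eq [Finite V] {d d' : G.Dart} (h : d.fst = d'.fst) :
    ∃ n : ℕ, (R.rot ^ n) d = d' := by
  classical
  have := Fintype.ofFinite V
  obtain ⟨n, -, h⟩ := (R.rot_sameCycle d d' h).exists_pow_eq'
  exact ⟨n, h⟩

theorem exists_next_pow_eq [Finite V] {d d' : G.Dart} (h : R.faceOf d = R.faceOf d') :
    ∃ n : ℕ, (R.next ^ n) d = d' := by
  classical
  have := Fintype.ofFinite V
  obtain ⟨n, -, h⟩ := (R.faceOf_eq_iff.1 h).exists_pow_eq'
  exact ⟨n, h⟩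

/-- A function on the darts that is invariant under reversal and rotation is constant. -/
theorem eq_of_invariant [Finite V] (hG : G.Preconnected) {X : Type*} (c : G.Dart → X)
    (hsymm : ∀ d, c d.symm = c d) (hrot : ∀ d, c (R.rot d) = c d) (d d' : G.Dart) :
    c d = c d' := by
  have hfst : ∀ d d' : G.Dart, d.fst = d'.fst → c d = c d' := by
    intro d d' h
    obtain ⟨n, rfl⟩ := R.exists_rot_pow_eq h
    clear h
    induction n with
    | zero => rfl
    | succ n ih => rw [pow_succ', Equiv.Perm.mul_apply, hrot, ih]
  obtain ⟨p⟩ := hG d.fst d'.fst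
  generalize hu : d.fst = u at p
  generalize hv : d'.fst = v at p
  induction p generalizing d with
  | nil => exact hfst _ _ (hu.trans hv.symm)
  | @cons u w v h p ih =>
    rw [← ih ⟨(w, u), h.symm⟩ rfl hv, hfst d ⟨(u, w), h⟩ hu]
    exact hsymm ⟨(w, u), h.symm⟩

end RotationSystem

/-! ### Closed walks as sums of face boundaries -/

namespace PlaneEmbedding

variable {V : Type*} [Fintype V] {G : SimpleGraph V} (P : PlaneEmbedding G)

/-- The dual graph is connected: read on darts, such a label is invariant under reversal and
rotation. -/
theorem faceLabel_const (c : P.Face → ZMod 2)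
    (h : ∀ d, c (P.faceOf d) = c (P.faceOf d.symm)) (s t : P.Face) : c s = c t := by
  obtain ⟨d, rfl⟩ := P.exists_faceOf_eq s
  obtain ⟨d', rfl⟩ := P.exists_faceOf_eq t
  refine P.eq_of_invariant P.connected.preconnected (fun d => c (P.faceOf d))
    (fun d => (h d).symm) (fun d => ?_) d d'
  rw [P.faceOf_rot, h d]

/-- The cycle space of a plane graph is spanned by the boundaries of its faces. -/
theorem exists_faceLabel [DecidableEq V] [DecidableRel G.Adj] (z : Sym2 V → ZMod 2)
    (hz : ∀ v, ∑ d : G.Dart with d.fst = v, z d.edge = 0) :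
    ∃ c : P.Face → ZMod 2, ∀ d : G.Dart, z d.edge = c (P.faceOf d) + c (P.faceOf d.symm) := by
  classical
  have := Fintype.ofFinite P.Face
  let M := SimpleGraph.dartMatrix (G := G) fun d => d.fst
  let D := SimpleGraph.dartMatrix P.faceOf
  have hM : Fintype.card V ≤ M.rank + 1 := by
    refine SimpleGraph.card_le_rank_dartMatrix_add_one _ fun c hc x y => ?_
    obtain ⟨p⟩ := P.connected.preconnected x y
    induction p with
    | nil => rfl
    | cons h p ih => rw [← ih]; exact hc ⟨(_, _), h⟩
  have hD : Fintype.card P.Face ≤ D.rank + 1 :=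
    SimpleGraph.card_le_rank_dartMatrix_add_one _ fun c hc => P.faceLabel_const c hc
  have hker := LinearMap.finrank_range_add_finrank_ker M.transpose.mulVecLin
  rw [Module.finrank_fintype_fun_eq_card] at hker
  have hMt : Module.finrank (ZMod 2) (LinearMap.range M.transpose.mulVecLin) = M.rank :=
    M.rank_transpose
  have hle : LinearMap.range D.mulVecLin ≤ LinearMap.ker M.transpose.mulVecLin := by
    rintro _ ⟨c, rfl⟩
    rw [LinearMap.mem_ker, Matrix.mulVecLin_apply, Matrix.mulVecLin_apply]
    funext v
    rw [SimpleGraph.dartMatrix_transpose_mulVec]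
    simp only [D, SimpleGraph.dartMatrix_mulVec, Finset.sum_add_distrib]
    -- A face enters a vertex as often as it leaves it, so face boundaries are cycles; rotation
    -- matches the two sums.
    have : ∑ d : G.Dart with d.fst = v, c (P.faceOf d.symm)
        = ∑ d : G.Dart with d.fst = v, c (P.faceOf d) := by
      refine Finset.sum_equiv P.rot (fun d => ?_) fun d _ => ?_
      · simp [P.rot_fst]
      · rw [P.faceOf_rot]
    rw [this]
    exact CharTwo.add_self_eq_zero _
  have heuler := P.euler
  rw [Nat.card_eq_fintype_card, Nat.card_eq_fintype_card, Nat.card_eq_fintype_card] at heuler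
  -- Dimension count: the cycle space has dimension at most |E| - |V| + 1 = |F| - 1, which is at
  -- most the rank of `D`.
  have heq : LinearMap.range D.mulVecLin = LinearMap.ker M.transpose.mulVecLin := by
    refine Submodule.eq_of_le_of_finrank_le hle ?_
    change _ ≤ D.rank
    omega
  have hmem : (fun e : G.edgeSet => z e) ∈ LinearMap.ker M.transpose.mulVecLin := by
    rw [LinearMap.mem_ker, Matrix.mulVecLin_apply]
    funext v
    rw [SimpleGraph.dartMatrix_transpose_mulVec]
    exact hz v
  rw [← heq] at hmem
  obtain ⟨c, hc⟩ := hmem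
  refine ⟨c, fun d => ?_⟩
  rw [← SimpleGraph.dartMatrix_mulVec P.faceOf c d]
  exact (congrFun hc ⟨d.edge, d.edge_mem⟩).symm

theorem exists_faceLabel_of_closed_walk [DecidableEq V] {a : V} (p : G.Walk a a) :
    ∃ c : P.Face → ZMod 2, ∀ d : G.Dart,
      p.chain d.edge = c (P.faceOf d) + c (P.faceOf d.symm) := by
  classical
  refine P.exists_faceLabel p.chain fun v => ?_
  rw [p.sum_chain]
  exact CharTwo.add_self_eq_zero _

end PlaneEmbedding

/-! ### Boundary walks of faces -/

namespace RotationSystem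

variable {V : Type*} {G : SimpleGraph V} (R : RotationSystem G)

theorem next_pow_succ_fst (d : G.Dart) (n : ℕ) :
    ((R.next ^ (n + 1)) d).fst = ((R.next ^ n) d).snd := by
  rw [pow_succ', Equiv.Perm.mul_apply, next_fst]

/-- The number of darts on the boundary walk of the face of a dart. -/
noncomputable def faceLength (d : G.Dart) : ℕ := Function.minimalPeriod R.next d

theorem next_pow_faceLength (d : G.Dart) : (R.next ^ R.faceLength d) d = d := by
  rw [← Equiv.Perm.iterate_eq_pow]
  exact Function.iterate_minimalPeriod

theorem eq_of_next_pow_eq {d : G.Dart} {m n : ℕ} (hm : m < R.faceLength d)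
    (hn : n < R.faceLength d) (h : (R.next ^ m) d = (R.next ^ n) d) : m = n := by
  rw [← Equiv.Perm.iterate_eq_pow, ← Equiv.Perm.iterate_eq_pow] at h
  exact Function.iterate_injOn_Iio_minimalPeriod hm hn h

theorem exists_next_pow_eq_of_lt [Finite V] {d d' : G.Dart} (h : R.faceOf d = R.faceOf d') :
    ∃ n < R.faceLength d, (R.next ^ n) d = d' := by
  obtain ⟨n, rfl⟩ := R.exists_next_pow_eq h
  have hpos : 0 < R.faceLength d := by
    classical
    have := Fintype.ofFinite V
    refine Function.minimalPeriod_pos_of_mem_periodicPts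
      ⟨orderOf R.next, orderOf_pos R.next, ?_⟩
    rw [Function.IsPeriodicPt, Function.IsFixedPt, Equiv.Perm.iterate_eq_pow, pow_orderOf_eq_one]
    rfl
  refine ⟨n % R.faceLength d, Nat.mod_lt _ hpos, ?_⟩
  rw [← Equiv.Perm.iterate_eq_pow, ← Equiv.Perm.iterate_eq_pow]
  exact Function.iterate_mod_minimalPeriod_eq

theorem faceLength_next (d : G.Dart) : R.faceLength (R.next d) = R.faceLength d := by
  by_cases hd : d ∈ Function.periodicPts R.next
  · exact Function.minimalPeriod_apply hd
  · have hd' : R.next d ∉ Function.periodicPts R.next := by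
      rintro ⟨n, hn, h⟩
      refine hd ⟨n, hn, R.next.injective ?_⟩
      exact (Function.iterate_succ_apply' R.next n d).symm.trans
        ((Function.iterate_succ_apply R.next n d).trans h)
    rw [faceLength, faceLength, Function.minimalPeriod_eq_zero_of_notMem_periodicPts hd,
      Function.minimalPeriod_eq_zero_of_notMem_periodicPts hd']

/-- The walk along the boundary of a face. -/
theorem exists_faceWalk (d : G.Dart) (n : ℕ) :
    ∃ p : G.Walk d.fst ((R.next ^ n) d).fst,
      p.darts = (List.range n).map (fun i => (R.next ^ i) d) ∧
      p.support = (List.range (n + 1)).map (fun i => ((R.next ^ i) d).fst) := by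
  induction n with
  | zero => exact ⟨SimpleGraph.Walk.nil, rfl, rfl⟩
  | succ n ih =>
    obtain ⟨p, hp, hs⟩ := ih
    refine ⟨(p.concat ((R.next ^ n) d).adj).copy rfl (R.next_pow_succ_fst d n).symm, ?_, ?_⟩
    · rw [SimpleGraph.Walk.darts_copy, SimpleGraph.Walk.darts_concat, hp, List.range_succ]
      simp
    · rw [SimpleGraph.Walk.support_copy, SimpleGraph.Walk.support_concat, hs,
        List.range_succ (n := n + 1)]
      simp only [List.map_append, List.map_cons, List.map_nil, R.next_pow_succ_fst d n]

end RotationSystem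

namespace SimpleGraph.Walk

variable {V : Type*} [DecidableEq V] {G : SimpleGraph V}

theorem chain_eq_count_darts {a b : V} (p : G.Walk a b) (d : G.Dart) :
    p.chain d.edge = (p.darts.count d + p.darts.count d.symm : ℕ) := by
  rw [chain, edges]
  congr 1
  induction p.darts with
  | nil => simp
  | cons d' l ih =>
    simp only [List.map_cons, List.count_cons, ih, beq_iff_eq, dart_edge_eq_iff]
    by_cases h1 : d' = d
    · subst h1
      simp [d'.symm_ne.symm, add_right_comm]
    · by_cases h2 : d' = d.symm <;> simp [h1, h2, d.symm_ne, add_assoc]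

theorem chain_of_edge_notMem {a b : V} (p : G.Walk a b) {d : G.Dart} (h : d ∉ p.darts)
    (h' : d.symm ∉ p.darts) : p.chain d.edge = 0 := by
  rw [chain_eq_count_darts, List.count_eq_zero_of_not_mem h, List.count_eq_zero_of_not_mem h']
  rfl

end SimpleGraph.Walk

/-! ### Separation properties of 2-connected outerplane graphs -/

namespace PlaneEmbedding

variable {V : Type*} [Fintype V] {G : SimpleGraph V} (P : PlaneEmbedding G)

/-- A face visits a vertex only once. Otherwise close up the two darts by a path avoiding their
tail, which exists by 2-connectedness. In the rotation around the tail, the resulting face label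
changes only on passing these two darts, so it differs between their faces. -/
theorem dart_eq_of_fst_eq (h2 : G.IsTwoConnected) {d₁ d₂ : G.Dart} (hv : d₁.fst = d₂.fst)
    (hf : P.faceOf d₁ = P.faceOf d₂) : d₁ = d₂ := by
  classical
  obtain ⟨⟨v, a⟩, ha⟩ := d₁
  obtain ⟨⟨v', b⟩, hb⟩ := d₂
  change v = v' at hv
  subst hv
  change G.Adj v a at ha
  change G.Adj v b at hb
  by_contra hne
  obtain ⟨q₀⟩ := (h2.2.2 v).preconnected ⟨a, ha.ne'⟩ ⟨b, hb.ne'⟩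
  let q : G.Walk a b := q₀.map (SimpleGraph.Embedding.induce _).toHom
  have hq : v ∉ q.support := by
    intro h
    rw [show q.support = _ from SimpleGraph.Walk.support_map _ _, List.mem_map] at h
    obtain ⟨w, -, hw⟩ := h
    exact w.2 hw
  obtain ⟨c, hc⟩ := P.exists_faceLabel_of_closed_walk
    (SimpleGraph.Walk.cons ha (q.append (SimpleGraph.Walk.cons hb.symm SimpleGraph.Walk.nil)))
  have hstep : ∀ d : G.Dart, d.fst = v → c (P.faceOf (P.rot d))
      = c (P.faceOf d) + ((if d = ⟨(v, b), hb⟩ then 1 else 0)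
        + if d = ⟨(v, a), ha⟩ then 1 else 0) := by
    rintro ⟨⟨w, x⟩, hx⟩ hw
    change w = v at hw
    subst hw
    have h := hc ⟨(w, x), hx⟩
    rw [SimpleGraph.Walk.chain_cons, SimpleGraph.Walk.chain_append, SimpleGraph.Walk.chain_cons,
      q.chain_eq_zero_of_notMem_support hq (by simp [SimpleGraph.Dart.edge]),
      ← P.faceOf_rot] at h
    have e1 : (s(w, a) = SimpleGraph.Dart.edge ⟨(w, x), hx⟩) ↔
        (⟨(w, x), hx⟩ : G.Dart) = ⟨(w, a), ha⟩ := by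
      simp [SimpleGraph.Dart.edge, SimpleGraph.Dart.ext_iff, eq_comm (a := x)]
      grind
    have e2 : (s(b, w) = SimpleGraph.Dart.edge ⟨(w, x), hx⟩) ↔
        (⟨(w, x), hx⟩ : G.Dart) = ⟨(w, b), hb⟩ := by
      rw [Sym2.eq_swap]
      simp [SimpleGraph.Dart.edge, SimpleGraph.Dart.ext_iff, eq_comm (a := x)]
      grind
    simp only [e1, e2, SimpleGraph.Walk.chain_nil] at h
    have := CharTwo.add_self_eq_zero (c (P.faceOf ⟨(w, x), hx⟩))
    linear_combination -this - h
  have hex := P.exists_rot_pow_eq (d := ⟨(v, a), ha⟩) (d' := ⟨(v, b), hb⟩) rfl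
  have hk := Nat.find_spec hex
  have hmin := fun m => @Nat.find_min _ _ hex m
  set k := Nat.find hex
  have hk0 : k ≠ 0 := by
    intro h
    rw [h] at hk
    exact hne hk
  have hind : ∀ n < k, c (P.faceOf ((P.rot ^ (n + 1)) ⟨(v, a), ha⟩))
      = c (P.faceOf ⟨(v, a), ha⟩) + 1 := by
    intro n
    induction n with
    | zero =>
      intro _
      rw [zero_add, pow_one, hstep _ rfl, if_neg hne, if_pos rfl, zero_add]
    | succ n ih =>
      intro hn
      rw [pow_succ', Equiv.Perm.mul_apply, hstep _ (P.rot_pow_fst _ _), ih (by omega), if_neg (hmin _ hn),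
        if_neg, zero_add, add_zero]
      intro h
      -- A return to the first dart before step `k` would make the second dart reachable in fewer
      -- steps.
      refine hmin (k - (n + 1)) (by omega) ?_
      rw [← hk]
      conv_lhs => rw [← h]
      rw [← Equiv.Perm.mul_apply, ← pow_add]
      congr 2
      omega
  have h := hind (k - 1) (by omega)
  rw [show k - 1 + 1 = k by omega, hk, ← hf] at h
  exact one_ne_zero (left_eq_add.1 h)

/-- An edge with the same face on both sides would be fixed by the rotation at its tail, which then
has degree 1 and is cut off by deleting the head. -/
theorem faceOf_symm_ne (h2 : G.IsTwoConnected) (d : G.Dart) : P.faceOf d.symm ≠ P.faceOf d := by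
  intro h
  have hrot : P.rot d = d := P.dart_eq_of_fst_eq h2 (P.rot_fst d) ((P.faceOf_rot d).trans h)
  have huniq : ∀ d' : G.Dart, d'.fst = d.fst → d' = d := by
    intro d' hd'
    obtain ⟨n, rfl⟩ := P.exists_rot_pow_eq hd'.symm
    clear hd'
    induction n with
    | zero => rfl
    | succ n ih => rw [pow_succ, Equiv.Perm.mul_apply, hrot, ih]
  obtain ⟨w, hw⟩ : ∃ w, w ∉ ({d.fst, d.snd} : Set V) := by
    by_contra hcon
    push Not at hcon
    have h3 : (Set.univ : Set V).ncard ≤ ({d.fst, d.snd} : Set V).ncard :=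
      Set.ncard_le_ncard (fun w _ => hcon w) (Set.toFinite _)
    have := Set.ncard_pair d.fst_ne_snd
    rw [Set.ncard_univ] at h3
    have := h2.1
    omega
  rw [Set.mem_insert_iff, Set.mem_singleton_iff, not_or] at hw
  obtain ⟨p⟩ := (h2.2.2 d.snd).preconnected ⟨d.fst, d.fst_ne_snd⟩ ⟨w, hw.2⟩
  cases p with
  | nil => exact hw.1 rfl
  | @cons _ x _ hx _ =>
    have hx' : G.Adj d.fst x := hx
    have := huniq ⟨(d.fst, x), hx'⟩ rfl
    exact x.2 (congrArg (fun d : G.Dart => d.snd) this)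

variable {P}

theorem exists_outer_dart (ho : P.IsOuterplane) (v : V) :
    ∃ d : G.Dart, d.fst = v ∧ P.faceOf d = P.outerFace := by
  obtain ⟨e, ⟨d, hd, he⟩, hv⟩ := ho v
  rw [← he, SimpleGraph.Dart.edge, Sym2.mem_iff] at hv
  rcases hv with h | h
  · exact ⟨d, h.symm, hd⟩
  · exact ⟨P.next d, (P.next_fst d).trans h.symm, (P.faceOf_next d).trans hd⟩

theorem exists_outer_walk (ho : P.IsOuterplane) (u v : V) :
    ∃ p : G.Walk u v, ∀ d ∈ p.darts, P.faceOf d = P.outerFace := by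
  obtain ⟨o, rfl, ho2⟩ := exists_outer_dart ho u
  obtain ⟨o', rfl, ho2'⟩ := exists_outer_dart ho v
  obtain ⟨n, rfl⟩ := P.exists_next_pow_eq (ho2.trans ho2'.symm)
  obtain ⟨p, hp, -⟩ := P.exists_faceWalk o n
  refine ⟨p, fun d hd => ?_⟩
  rw [hp, List.mem_map] at hd
  obtain ⟨m, -, rfl⟩ := hd
  rw [P.faceOf_next_pow, ho2]

/-- A closed walk does not separate the faces around a vertex which it does not visit. -/
theorem label_eq_outer [DecidableEq V] (ho : P.IsOuterplane) {a : V} {p : G.Walk a a}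
    {c : P.Face → ZMod 2}
    (hc : ∀ d : G.Dart, p.chain d.edge = c (P.faceOf d) + c (P.faceOf d.symm))
    {d : G.Dart} (hd : d.fst ∉ p.support) : c (P.faceOf d) = c P.outerFace := by
  obtain ⟨o, ho1, ho2⟩ := exists_outer_dart ho d.fst
  rw [← ho2]
  obtain ⟨n, rfl⟩ := P.exists_rot_pow_eq ho1.symm
  clear ho1 ho2
  induction n with
  | zero => rfl
  | succ n ih =>
    rw [ih, pow_succ', Equiv.Perm.mul_apply, P.faceOf_rot]
    have h := hc ((P.rot ^ n) d)
    rw [p.chain_eq_zero_of_notMem_support hd] at h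
    · exact CharTwo.add_eq_zero.1 h.symm
    · rw [← P.rot_pow_fst d n, SimpleGraph.Dart.edge]
      exact Sym2.mem_mk_left _ _

/-- Two pairs of vertices that alternate along the boundary of a finite face of an outerplane
graph cannot be joined by disjoint walks. -/
theorem mem_support_of_alternating (h2 : G.IsTwoConnected) (ho : P.IsOuterplane) {d : G.Dart}
    (hd : P.faceOf d ≠ P.outerFace) {i j k : ℕ} (hi : 0 < i) (hij : i < j) (hjk : j < k)
    (hk : k < P.faceLength d) (p : G.Walk d.fst ((P.next ^ j) d).fst) :
    ((P.next ^ i) d).fst ∈ p.support ∨ ((P.next ^ k) d).fst ∈ p.support := by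
  classical
  by_contra hcon
  rw [not_or] at hcon
  set N := P.faceLength d with hN
  have hinj : ∀ m < N, ∀ n < N, ((P.next ^ m) d).fst = ((P.next ^ n) d).fst → m = n := by
    intro m hm n hn h
    refine P.eq_of_next_pow_eq hm hn (P.dart_eq_of_fst_eq h2 h ?_)
    rw [P.faceOf_next_pow, P.faceOf_next_pow]
  obtain ⟨A, hA, hAs⟩ := P.exists_faceWalk d j
  obtain ⟨B, hB, hBs⟩ := P.exists_faceWalk ((P.next ^ j) d) (N - j)
  have hadd : ∀ m, (P.next ^ m) ((P.next ^ j) d) = (P.next ^ (j + m)) d := by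
    intro m
    rw [← Equiv.Perm.mul_apply, ← pow_add, add_comm]
  have hend : (P.next ^ (N - j)) ((P.next ^ j) d) = d := by
    rw [hadd, show j + (N - j) = N by omega, P.next_pow_faceLength]
  -- The two ends of `p` cut the boundary of the face into the arcs `A` and `B`. Closing `p` by
  -- either arc gives a closed walk that misses one of the other two vertices, so each label takes
  -- the same value on this face and on the outer face.
  obtain ⟨c, hc⟩ := P.exists_faceLabel_of_closed_walk (p.append A.reverse)
  obtain ⟨c', hc'⟩ := P.exists_faceLabel_of_closed_walk
    (p.append (B.copy rfl (congrArg (fun d : G.Dart => d.fst) hend)))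
  have h1 : c (P.faceOf d) = c P.outerFace := by
    rw [← P.faceOf_next_pow k d]
    refine label_eq_outer ho hc ?_
    rw [SimpleGraph.Walk.mem_support_append_iff, not_or]
    refine ⟨hcon.2, ?_⟩
    rw [SimpleGraph.Walk.support_reverse, List.mem_reverse, hAs, List.mem_map]
    rintro ⟨m, hm, h⟩
    rw [List.mem_range] at hm
    have := hinj m (by omega) k hk h
    omega
  have h2 : c' (P.faceOf d) = c' P.outerFace := by
    rw [← P.faceOf_next_pow i d]
    refine label_eq_outer ho hc' ?_
    rw [SimpleGraph.Walk.mem_support_append_iff, not_or]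
    refine ⟨hcon.1, ?_⟩
    rw [SimpleGraph.Walk.support_copy, hBs, List.mem_map]
    rintro ⟨m, hm, h⟩
    rw [List.mem_range] at hm
    rw [hadd] at h
    by_cases hmN : j + m = N
    · rw [hmN, P.next_pow_faceLength] at h
      have := hinj 0 (by omega) i (by omega) h
      omega
    · have := hinj (j + m) (by omega) i (by omega) h
      omega
  have hcount : ∀ d' : G.Dart, ((A.darts ++ B.darts).count d' : ZMod 2)
      = if P.faceOf d' = P.faceOf d then 1 else 0 := by
    intro d'
    have hl : A.darts ++ B.darts = (List.range N).map fun m => (P.next ^ m) d := by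
      conv_rhs => rw [show N = j + (N - j) by omega, List.range_add, List.map_append, List.map_map]
      rw [hA, hB]
      congr 1
      refine List.map_congr_left fun m _ => ?_
      rw [hadd]
      rfl
    have hnd : (A.darts ++ B.darts).Nodup := by
      rw [hl]
      refine List.Nodup.map_on ?_ List.nodup_range
      intro m hm n hn h
      exact P.eq_of_next_pow_eq (List.mem_range.1 hm) (List.mem_range.1 hn) h
    rw [hnd.count]
    have : d' ∈ A.darts ++ B.darts ↔ P.faceOf d' = P.faceOf d := by
      rw [hl, List.mem_map]
      constructor
      · rintro ⟨m, -, rfl⟩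
        exact P.faceOf_next_pow m d
      · intro h
        obtain ⟨m, hm, h⟩ := P.exists_next_pow_eq_of_lt h.symm
        exact ⟨m, List.mem_range.2 hm, h⟩
    by_cases h : P.faceOf d' = P.faceOf d <;> simp [this, h]
  -- The two closed walks add up to the boundary of the face, so the sum of their labels differs
  -- from the indicator of the face by a constant. But that sum agrees on this face and the outer
  -- face, while the indicator does not.
  have hconst := P.faceLabel_const
    (fun s => c s + c' s + if s = P.faceOf d then 1 else 0) ?_ (P.faceOf d) P.outerFace
  · simp only [h1, h2, if_pos, if_neg hd.symm] at hconst
    simp at hconst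
  · intro d'
    have e1 := hc d'
    have e2 := hc' d'
    have e3 := hcount d'
    have e4 := hcount d'.symm
    rw [SimpleGraph.Walk.chain_append, SimpleGraph.Walk.chain_reverse,
      A.chain_eq_count_darts] at e1
    rw [SimpleGraph.Walk.chain_append, SimpleGraph.Walk.chain_eq_count_darts (B.copy _ _),
      SimpleGraph.Walk.darts_copy] at e2
    rw [List.count_append] at e3 e4
    push_cast at e1 e2 e3 e4
    have t1 := CharTwo.add_self_eq_zero (p.chain d'.edge)
    have t2 := CharTwo.add_self_eq_zero (c (P.faceOf d'.symm))
    have t3 := CharTwo.add_self_eq_zero (c' (P.faceOf d'.symm))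
    have t4 := CharTwo.add_self_eq_zero
      (if P.faceOf d' = P.faceOf d then (1 : ZMod 2) else 0)
    change c _ + c' _ + _ = c _ + c' _ + _
    linear_combination t1 - t2 - t3 + t4 - e1 - e2 + e3 + e4

/-- Two distinct finite faces of an outerplane graph have at most one common edge. -/
theorem dart_eq_of_faceOf_eq (h2 : G.IsTwoConnected) (ho : P.IsOuterplane) {d₁ d₂ : G.Dart}
    (hf : P.faceOf d₁ = P.faceOf d₂) (hf' : P.faceOf d₁.symm = P.faceOf d₂.symm)
    (hs : P.faceOf d₁ ≠ P.outerFace) (hs' : P.faceOf d₁.symm ≠ P.outerFace) : d₁ = d₂ := by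
  classical
  by_contra hne
  have hne' : d₂ ≠ d₁.symm := by
    rintro rfl
    exact P.faceOf_symm_ne h2 d₁ hf.symm
  -- Closing `d₁` along the periphery gives a closed walk through `d₁` once and never through `d₂`,
  -- although both edges separate the same two faces.
  obtain ⟨p, hmem⟩ := exists_outer_walk ho d₁.fst d₁.snd
  obtain ⟨c, hc⟩ := P.exists_faceLabel_of_closed_walk (SimpleGraph.Walk.cons d₁.adj.symm p)
  have hedge : s(d₁.snd, d₁.fst) = d₁.edge := Sym2.eq_swap
  have e1 := hc d₁
  have e2 := hc d₂
  rw [SimpleGraph.Walk.chain_cons, SimpleGraph.Walk.chain_of_edge_notMem, if_pos hedge] at e1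
  · rw [SimpleGraph.Walk.chain_cons, SimpleGraph.Walk.chain_of_edge_notMem, if_neg, ← hf,
      ← hf', ← e1] at e2
    · simp at e2
    · intro h
      rcases (SimpleGraph.dart_edge_eq_iff _ _).1 (h.symm.trans hedge) with h | h
      · exact hne h.symm
      · exact hne' h
    · exact fun h => hs (hf.trans (hmem _ h))
    · exact fun h => hs' (hf'.trans (hmem _ h))
  · exact fun h => hs (hmem _ h)
  · exact fun h => hs' (hmem _ h)

end PlaneEmbedding

/-! ### Distance in the line graph -/

namespace SimpleGraph

variable {V : Type*} {G : SimpleGraph V}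

theorem exists_walk_of_lineGraph_walk {e f : G.edgeSet} (w : G.lineGraph.Walk e f) (hef : e ≠ f) :
    ∃ a ∈ (e : Sym2 V), ∃ b ∈ (f : Sym2 V), ∃ p : G.Walk a b, p.length + 1 ≤ w.length := by
  induction w with
  | nil => exact absurd rfl hef
  | @cons e e' f h w ih =>
    obtain ⟨-, a, ha, ha'⟩ := lineGraph_adj_iff_exists.1 h
    by_cases he' : e' = f
    · subst he'
      exact ⟨a, ha, a, ha', Walk.nil, by simp⟩
    · obtain ⟨b, hb, c, hc, p, hp⟩ := ih he'
      by_cases hab : a = b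
      · subst hab
        refine ⟨a, ha, c, hc, p, ?_⟩
        rw [Walk.length_cons]
        omega
      · have hadj : G.Adj a b := by
          have := e'.2
          rwa [(Sym2.mem_and_mem_iff hab).1 ⟨ha', hb⟩, mem_edgeSet] at this
        refine ⟨a, ha, c, hc, Walk.cons hadj p, ?_⟩
        rw [Walk.length_cons, Walk.length_cons]
        omega

theorem exists_lineGraph_walk {a b : V} (p : G.Walk a b) {e f : G.edgeSet}
    (ha : a ∈ (e : Sym2 V)) (hb : b ∈ (f : Sym2 V)) :
    ∃ w : G.lineGraph.Walk e f, w.length ≤ p.length + 1 := by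
  have hadj : ∀ {e f : G.edgeSet} {c : V}, c ∈ (e : Sym2 V) → c ∈ (f : Sym2 V) → e ≠ f →
      G.lineGraph.Adj e f := fun he hf hne => ⟨hne, _, he, hf⟩
  induction p generalizing e with
  | nil =>
    by_cases hef : e = f
    · subst hef
      exact ⟨Walk.nil, by simp⟩
    · exact ⟨Walk.cons (hadj ha hb hef) Walk.nil, by simp⟩
  | @cons a c b h p ih =>
    obtain ⟨w, hw⟩ := ih (e := ⟨s(a, c), h⟩) (Sym2.mem_mk_right _ _) hb
    by_cases he : e = ⟨s(a, c), h⟩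
    · subst he
      refine ⟨w, ?_⟩
      rw [Walk.length_cons]
      omega
    · refine ⟨Walk.cons (hadj ha (Sym2.mem_mk_left _ _) he) w, ?_⟩
      rw [Walk.length_cons, Walk.length_cons]
      omega

/-- The distance of two edges in the line graph, in terms of the walks between their ends. -/
theorem exists_walk_length_eq_lineGraph_dist (hG : G.Preconnected) {e f : G.edgeSet}
    (hef : e ≠ f) :
    ∃ a ∈ (e : Sym2 V), ∃ b ∈ (f : Sym2 V), ∃ p : G.Walk a b,
      G.lineGraph.dist e f = p.length + 1 ∧
      ∀ a' ∈ (e : Sym2 V), ∀ b' ∈ (f : Sym2 V), ∀ q : G.Walk a' b', p.length ≤ q.length := by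
  have hreach : G.lineGraph.Reachable e f := by
    obtain ⟨a, ha⟩ : ∃ a, a ∈ (e : Sym2 V) := ⟨_, Sym2.out_fst_mem _⟩
    obtain ⟨b, hb⟩ : ∃ b, b ∈ (f : Sym2 V) := ⟨_, Sym2.out_fst_mem _⟩
    obtain ⟨p⟩ := hG a b
    exact ⟨(exists_lineGraph_walk p ha hb).choose⟩
  have hle : ∀ a' ∈ (e : Sym2 V), ∀ b' ∈ (f : Sym2 V), ∀ q : G.Walk a' b',
      G.lineGraph.dist e f ≤ q.length + 1 := by
    intro a ha b hb q
    obtain ⟨w, hw⟩ := exists_lineGraph_walk q ha hb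
    exact (dist_le w).trans hw
  obtain ⟨w, hw⟩ := hreach.exists_walk_length_eq_dist
  obtain ⟨a, ha, b, hb, p, hp⟩ := exists_walk_of_lineGraph_walk w hef
  have h := hle a ha b hb p
  refine ⟨a, ha, b, hb, p, by omega, fun a' ha' b' hb' q => ?_⟩
  have := hle a' ha' b' hb' q
  omega

end SimpleGraph

/-! ### Parity of distances and colors of tails -/

namespace PlaneEmbedding

variable {V : Type*} [Fintype V] {G : SimpleGraph V} {P : PlaneEmbedding G}

/-- Along the face the two tails alternate with the two heads. If the darts are consecutive, a head
coincides with an end of the walk. -/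
theorem snd_mem_support_of_walk_fst_fst (h2 : G.IsTwoConnected) (ho : P.IsOuterplane)
    {d₁ d₂ : G.Dart} (hf : P.faceOf d₁ = P.faceOf d₂) (hs : P.faceOf d₁ ≠ P.outerFace)
    (hne : d₁ ≠ d₂) (p : G.Walk d₁.fst d₂.fst) : d₁.snd ∈ p.support ∨ d₂.snd ∈ p.support := by
  obtain ⟨j, hj, rfl⟩ := P.exists_next_pow_eq_of_lt hf
  have hj0 : j ≠ 0 := by rintro rfl; exact hne rfl
  rw [← P.next_pow_succ_fst d₁ j, show d₁.snd = _ from (P.next_pow_succ_fst d₁ 0).symm]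
  by_cases h1 : j = 1
  · subst h1
    exact Or.inl p.end_mem_support
  by_cases h3 : j + 1 = P.faceLength d₁
  · rw [h3, P.next_pow_faceLength]
    exact Or.inr p.start_mem_support
  exact mem_support_of_alternating h2 ho hs (by omega) (by omega) (by omega) (by omega) p

theorem fst_mem_support_of_walk_snd_snd (h2 : G.IsTwoConnected) (ho : P.IsOuterplane)
    {d₁ d₂ : G.Dart} (hf : P.faceOf d₁ = P.faceOf d₂) (hs : P.faceOf d₁ ≠ P.outerFace)
    (hne : d₁ ≠ d₂) (p : G.Walk d₁.snd d₂.snd) : d₁.fst ∈ p.support ∨ d₂.fst ∈ p.support := by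
  obtain ⟨j, hj, rfl⟩ := P.exists_next_pow_eq_of_lt hf
  have hj0 : j ≠ 0 := by rintro rfl; exact hne rfl
  have hstep : ∀ m, (P.next ^ m) (P.next d₁) = (P.next ^ (m + 1)) d₁ := by
    intro m
    rw [pow_succ, Equiv.Perm.mul_apply]
  by_cases h1 : j = 1
  · subst h1
    right
    rw [show ((P.next ^ 1) d₁).fst = d₁.snd from P.next_fst d₁]
    exact p.start_mem_support
  by_cases h3 : j + 1 = P.faceLength d₁
  · left
    have h := P.next_pow_succ_fst d₁ j
    rw [h3, P.next_pow_faceLength] at h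
    rw [h]
    exact p.end_mem_support
  have hend : ((P.next ^ j) d₁).snd = ((P.next ^ j) (P.next d₁)).fst := by
    rw [hstep, P.next_pow_succ_fst]
  -- Counting starts at the head of `d₁`, so the tail of `d₂` has index `j - 1`, its head `j`, and
  -- the tail of `d₁` comes last.
  have h := mem_support_of_alternating h2 ho (d := P.next d₁) (i := j - 1) (j := j)
    (k := P.faceLength d₁ - 1) (by rwa [P.faceOf_next]) (by omega) (by omega) (by omega)
    (by rw [P.faceLength_next]; omega) (p.copy (P.next_fst d₁).symm hend)
  rw [SimpleGraph.Walk.support_copy, hstep, hstep, show j - 1 + 1 = j by omega,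
    show P.faceLength d₁ - 1 + 1 = P.faceLength d₁ by omega, P.next_pow_faceLength] at h
  exact h.symm

/-- Two edges of a finite face have odd distance in the line graph if and only if, along the
boundary of the face, their tails have different colors. -/
theorem odd_lineGraph_dist_iff (h2 : G.IsTwoConnected) (ho : P.IsOuterplane)
    (C : G.Coloring Bool) {d₁ d₂ : G.Dart} (hf : P.faceOf d₁ = P.faceOf d₂)
    (hs : P.faceOf d₁ ≠ P.outerFace) (hne : d₁ ≠ d₂) :
    Odd (G.lineGraph.dist ⟨d₁.edge, d₁.edge_mem⟩ ⟨d₂.edge, d₂.edge_mem⟩)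
      ↔ C d₁.fst ≠ C d₂.fst := by
  have hedge : (⟨d₁.edge, d₁.edge_mem⟩ : G.edgeSet) ≠ ⟨d₂.edge, d₂.edge_mem⟩ := by
    intro h
    rcases (SimpleGraph.dart_edge_eq_iff _ _).1 (Subtype.ext_iff.1 h) with h | h
    · exact hne h
    · rw [h] at hf
      exact P.faceOf_symm_ne h2 _ hf
  classical
  have hC₁ := C.valid d₁.adj
  have hC₂ := C.valid d₂.adj
  obtain ⟨a, ha, b, hb, p, hp, hmin⟩ :=
    SimpleGraph.exists_walk_length_eq_lineGraph_dist P.connected.preconnected hedge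
  have hmem₁ : ∀ w, w ∈ d₁.edge ↔ w = d₁.fst ∨ w = d₁.snd := fun w => Sym2.mem_iff
  have hmem₂ : ∀ w, w ∈ d₂.edge ↔ w = d₂.fst ∨ w = d₂.snd := fun w => Sym2.mem_iff
  simp only [hmem₁, hmem₂] at ha hb hmin
  -- A shortest path between the two edges meets each of them only in its own endpoint.
  have hleft : ∀ w, (w = d₁.fst ∨ w = d₁.snd) → w ≠ a → w ∉ p.support := by
    intro w hw hwa hws
    exact (SimpleGraph.Walk.length_dropUntil_lt_length hws hwa).not_ge (hmin w hw b hb _)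
  have hright : ∀ w, (w = d₂.fst ∨ w = d₂.snd) → w ≠ b → w ∉ p.support := by
    intro w hw hwb hws
    exact (SimpleGraph.Walk.length_takeUntil_lt_length hws hwb).not_ge (hmin a ha w hw _)
  have hpar := C.even_length_iff_congr p
  rw [hp, Nat.odd_add_one, Nat.not_odd_iff_even, hpar]
  rcases ha with rfl | rfl <;> rcases hb with rfl | rfl
  · exfalso
    rcases snd_mem_support_of_walk_fst_fst h2 ho hf hs hne p with h | h
    · exact hleft _ (Or.inr rfl) d₁.fst_ne_snd.symm h
    · exact hright _ (Or.inr rfl) d₂.fst_ne_snd.symm h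
  · revert hC₁ hC₂
    cases C d₁.fst <;> cases C d₁.snd <;> cases C d₂.fst <;> cases C d₂.snd <;> simp
  · revert hC₁ hC₂
    cases C d₁.fst <;> cases C d₁.snd <;> cases C d₂.fst <;> cases C d₂.snd <;> simp
  · exfalso
    rcases fst_mem_support_of_walk_snd_snd h2 ho hf hs hne p with h | h
    · exact hleft _ (Or.inl rfl) d₁.fst_ne_snd h
    · exact hright _ (Or.inl rfl) d₂.fst_ne_snd h

/-- A dart is a chord dart if its edge separates two finite faces. -/
def IsChordDart (P : PlaneEmbedding G) (d : G.Dart) : Prop :=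
  P.faceOf d ≠ P.outerFace ∧ P.faceOf d.symm ≠ P.outerFace

theorem IsChordDart.symm {d : G.Dart} (h : P.IsChordDart d) : P.IsChordDart d.symm := by
  refine ⟨h.2, ?_⟩
  rw [d.symm_symm]
  exact h.1

theorem not_hasLinearlyConnectedTriple_iff (h2 : G.IsTwoConnected) (ho : P.IsOuterplane)
    (C : G.Coloring Bool) :
    ¬ P.HasLinearlyConnectedTriple ↔ ∀ d₁ d₂ : G.Dart, P.IsChordDart d₁ → P.IsChordDart d₂ →
      P.faceOf d₁ = P.faceOf d₂ → C d₁.fst = C d₂.fst := by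
  constructor
  · intro h d₁ d₂ h₁ h₂ hf
    by_contra hC
    have hne : d₁ ≠ d₂ := fun h => hC (by rw [h])
    refine h ⟨P.faceOf d₁.symm, P.faceOf d₁, P.faceOf d₂.symm, ⟨d₁.edge, d₁.edge_mem⟩,
      ⟨d₂.edge, d₂.edge_mem⟩, ⟨⟨h₁.2, h₁.1, h₂.2⟩, ⟨P.faceOf_symm_ne h2 d₁, ?_, ?_⟩,
      ⟨⟨d₁.symm, rfl, d₁.edge_symm⟩, d₁, rfl, rfl⟩, ⟨d₂, hf.symm, rfl⟩,
      d₂.symm, rfl, d₂.edge_symm⟩, (odd_lineGraph_dist_iff h2 ho C hf h₁.1 hne).2 hC⟩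
    · rw [hf]
      exact (P.faceOf_symm_ne h2 d₂).symm
    -- The outer two faces of the triple are distinct because finite faces share at most one edge.
    · exact fun hf' => hne (dart_eq_of_faceOf_eq h2 ho hf hf' h₁.1 h₁.2)
  · rintro h ⟨s, s', s'', ⟨_, he⟩, ⟨_, hf⟩, ⟨⟨ho₁, ho₂, ho₃⟩, ⟨hne₁, hne₂, hne₃⟩,
      ⟨⟨d₁', rfl, rfl⟩, d₁, rfl, hd₁⟩, ⟨d₂, hd₂, rfl⟩, d₂', rfl, hd₂'⟩, hodd⟩
    obtain rfl : d₁' = d₁.symm := by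
      rcases (SimpleGraph.dart_edge_eq_iff _ _).1 hd₁ with h | h
      · exact absurd (congrArg P.faceOf h.symm) hne₁
      · rw [h, SimpleGraph.Dart.symm_symm]
    obtain rfl : d₂' = d₂.symm := by
      rcases (SimpleGraph.dart_edge_eq_iff _ _).1 hd₂' with h | h
      · exact absurd (hd₂.symm.trans (congrArg P.faceOf h.symm)) hne₂
      · exact h
    have hne : d₁ ≠ d₂ := by
      rintro rfl
      exact hne₃ rfl
    refine (odd_lineGraph_dist_iff h2 ho C hd₂.symm ho₂ hne).1 ?_
      (h d₁ d₂ ⟨ho₂, ho₁⟩ ⟨hd₂ ▸ ho₂, ho₃⟩ hd₂.symm)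
    convert hodd using 3

end PlaneEmbedding

/-! ### Rotation and vertex degrees -/

namespace RotationSystem

variable {V : Type*} [Fintype V] {G : SimpleGraph V} (R : RotationSystem G)

theorem minimalPeriod_rot [DecidableRel G.Adj] (d : G.Dart) :
    Function.minimalPeriod R.rot d = G.degree d.fst := by
  classical
  rw [← G.dart_fst_fiber_card_eq_degree]
  have hpos : 0 < Function.minimalPeriod R.rot d := by
    refine Function.minimalPeriod_pos_of_mem_periodicPts ⟨orderOf R.rot, orderOf_pos R.rot, ?_⟩
    rw [Function.IsPeriodicPt, Function.IsFixedPt, Equiv.Perm.iterate_eq_pow, pow_orderOf_eq_one]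
    rfl
  have himage : (Finset.univ.filter fun d' : G.Dart => d'.fst = d.fst)
      = (Finset.range (Function.minimalPeriod R.rot d)).image fun n => R.rot^[n] d := by
    ext d'
    simp only [Finset.mem_filter, Finset.mem_univ, true_and, Finset.mem_image, Finset.mem_range]
    constructor
    · intro h
      obtain ⟨n, rfl⟩ := R.exists_rot_pow_eq h.symm
      refine ⟨n % Function.minimalPeriod R.rot d, Nat.mod_lt _ hpos, ?_⟩
      rw [← Equiv.Perm.iterate_eq_pow]
      exact Function.iterate_mod_minimalPeriod_eq
    · rintro ⟨n, -, rfl⟩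
      rw [Equiv.Perm.iterate_eq_pow, R.rot_pow_fst]
  rw [himage, Finset.card_image_of_injOn, Finset.card_range]
  intro m hm n hn h
  exact Function.iterate_injOn_Iio_minimalPeriod (Finset.mem_range.1 hm) (Finset.mem_range.1 hn) h

theorem rot_pow_eq_self_iff [DecidableRel G.Adj] {d : G.Dart} {n : ℕ} :
    (R.rot ^ n) d = d ↔ G.degree d.fst ∣ n := by
  rw [← R.minimalPeriod_rot, ← Function.isPeriodicPt_iff_minimalPeriod_dvd,
    ← Equiv.Perm.iterate_eq_pow]
  rfl

theorem exists_rot_pow_eq_of_lt_degree [DecidableRel G.Adj] {d d' : G.Dart} (h : d.fst = d'.fst) :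
    ∃ n < G.degree d.fst, (R.rot ^ n) d = d' := by
  obtain ⟨n, rfl⟩ := R.exists_rot_pow_eq h
  refine ⟨n % G.degree d.fst,
    Nat.mod_lt _ ((G.degree_pos_iff_exists_adj _).2 ⟨d.snd, d.adj⟩), ?_⟩
  rw [← R.minimalPeriod_rot, ← Equiv.Perm.iterate_eq_pow, ← Equiv.Perm.iterate_eq_pow]
  exact Function.iterate_mod_minimalPeriod_eq

end RotationSystem

theorem SimpleGraph.Walk.reachable_of_darts {V : Type*} {G H : SimpleGraph V} {u v : V}
    (p : G.Walk u v) (h : ∀ d ∈ p.darts, H.Adj d.fst d.snd) : H.Reachable u v := by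
  induction p with
  | nil => exact SimpleGraph.Reachable.refl _
  | @cons u w v hadj p ih =>
    rw [SimpleGraph.Walk.darts_cons] at h
    have h1 : H.Adj u w := h ⟨(u, w), hadj⟩ List.mem_cons_self
    exact h1.reachable.trans (ih fun d hd => h d (List.mem_cons_of_mem _ hd))

/-! ### Peripheral matchings, chords and alternating colors -/

namespace PlaneEmbedding

variable {V : Type*} [Fintype V] {G : SimpleGraph V} {P : PlaneEmbedding G}

/-- Every second edge of the periphery, starting from the vertices of color `b`. -/
def peripheralMatching (P : PlaneEmbedding G) (C : G.Coloring Bool) (b : Bool) : G.Subgraph where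
  verts := Set.univ
  Adj u v := ∃ d : G.Dart, P.faceOf d = P.outerFace ∧ C d.fst = b ∧
    ((d.fst = u ∧ d.snd = v) ∨ (d.fst = v ∧ d.snd = u))
  adj_sub := by
    rintro u v ⟨d, -, -, ⟨rfl, rfl⟩ | ⟨rfl, rfl⟩⟩
    · exact d.adj
    · exact d.adj.symm
  edge_vert _ := Set.mem_univ _
  symm := ⟨fun _ _ ⟨d, hd, hb, h⟩ => ⟨d, hd, hb, h.symm⟩⟩

theorem isPerfectMatching_peripheralMatching (h2 : G.IsTwoConnected) (ho : P.IsOuterplane)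
    (C : G.Coloring Bool) (b : Bool) : (P.peripheralMatching C b).IsPerfectMatching := by
  rw [SimpleGraph.Subgraph.isPerfectMatching_iff]
  intro v
  obtain ⟨o, rfl, ho'⟩ := exists_outer_dart ho v
  by_cases hb : C o.fst = b
  · refine ⟨o.snd, ⟨o, ho', hb, Or.inl ⟨rfl, rfl⟩⟩, ?_⟩
    rintro w ⟨d, hd, hdb, ⟨h, rfl⟩ | ⟨rfl, h⟩⟩
    · rw [P.dart_eq_of_fst_eq h2 h (hd.trans ho'.symm)]
    · exact absurd (hdb.trans (by rw [h, hb])) (C.valid d.adj)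
  -- A vertex of the other color is matched along the peripheral dart that enters it, whose tail has
  -- color `b`.
  · obtain ⟨o, rfl⟩ := P.next.surjective o
    rw [P.faceOf_next] at ho'
    rw [P.next_fst] at hb ⊢
    refine ⟨o.fst, ⟨o, ho', ?_, Or.inr ⟨rfl, rfl⟩⟩, ?_⟩
    · have := C.valid o.adj
      revert hb this
      cases b <;> cases C o.fst <;> cases C o.snd <;> simp
    · rintro w ⟨d, hd, hdb, ⟨h, rfl⟩ | ⟨rfl, h⟩⟩
      · exact absurd (h ▸ hdb) hb
      · have : P.next d = P.next o := by
          refine P.dart_eq_of_fst_eq h2 ?_ ?_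
          · rw [P.next_fst, P.next_fst, h]
          · rw [P.faceOf_next, P.faceOf_next, hd, ho']
        rw [P.next.injective this]

theorem isElementary_of_isOuterplane (h2 : G.IsTwoConnected) (ho : P.IsOuterplane)
    (C : G.Coloring Bool) : G.IsElementary := by
  refine ⟨⟨_, isPerfectMatching_peripheralMatching h2 ho C true⟩, ?_⟩
  have := h2.2.1.nonempty
  refine ⟨fun u v => ?_⟩
  obtain ⟨p, hp⟩ := exists_outer_walk ho u v
  exact p.reachable_of_darts fun d hd => ⟨_, isPerfectMatching_peripheralMatching h2 ho C (C d.fst),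
    d, hp d hd, rfl, Or.inl ⟨rfl, rfl⟩⟩

section Degree

variable [DecidableRel G.Adj]

theorem two_le_degree (h2 : G.IsTwoConnected) (ho : P.IsOuterplane) (v : V) : 2 ≤ G.degree v := by
  obtain ⟨o, rfl, -⟩ := exists_outer_dart ho v
  have hpos := (G.degree_pos_iff_exists_adj _).2 ⟨o.snd, o.adj⟩
  by_contra hlt
  have hrot : (P.rot ^ 1) o = o := P.rot_pow_eq_self_iff.2 (by rw [show G.degree o.fst = 1 by omega])
  refine P.faceOf_symm_ne h2 o ?_
  rw [← P.faceOf_rot, ← pow_one P.rot, hrot]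

/-- The outer face occupies only one corner at a vertex, so only the first and the last dart in the
rotation from `o` are peripheral. -/
theorem isChordDart_rot_pow (h2 : G.IsTwoConnected) {o : G.Dart} (ho' : P.faceOf o = P.outerFace)
    {k : ℕ} (hk : 0 < k) (hk' : k + 1 < G.degree o.fst) : P.IsChordDart ((P.rot ^ k) o) := by
  have key : ∀ m, 0 < m → m < G.degree o.fst → P.faceOf ((P.rot ^ m) o) ≠ P.outerFace := by
    intro m hm hm' h
    have := P.dart_eq_of_fst_eq h2 (P.rot_pow_fst o m) (h.trans ho'.symm)
    exact Nat.not_dvd_of_pos_of_lt hm hm' (P.rot_pow_eq_self_iff.1 this)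
  refine ⟨key k hk (by omega), ?_⟩
  rw [← P.faceOf_rot, ← Equiv.Perm.mul_apply, ← pow_succ']
  exact key (k + 1) (by omega) hk'

theorem isChordDart_rot (h2 : G.IsTwoConnected) {o : G.Dart} (ho' : P.faceOf o = P.outerFace)
    (h3 : G.degree o.fst = 3) : P.IsChordDart (P.rot o) := by
  rw [← pow_one P.rot]
  exact isChordDart_rot_pow h2 ho' one_pos (by omega)

theorem IsChordDart.degree_eq_three (ho : P.IsOuterplane)
    (hdeg : ∀ v, G.degree v = 2 ∨ G.degree v = 3) {t : G.Dart} (ht : P.IsChordDart t) :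
    G.degree t.fst = 3 ∧ ∃ o : G.Dart, P.faceOf o = P.outerFace ∧ P.rot o = t := by
  obtain ⟨o, hv, ho'⟩ := exists_outer_dart ho t.fst
  obtain ⟨k, hk, hkt⟩ := P.exists_rot_pow_eq_of_lt_degree hv
  have hk0 : k ≠ 0 := by
    rintro rfl
    exact ht.1 (hkt ▸ ho')
  have hlast : k + 1 ≠ G.degree o.fst := by
    intro h
    refine ht.2 ?_
    rw [← P.faceOf_rot, ← hkt, ← Equiv.Perm.mul_apply, ← pow_succ',
      P.rot_pow_eq_self_iff.2 (by rw [h]), ho']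
  have hv' := hdeg o.fst
  rw [← hv]
  refine ⟨by omega, o, ho', ?_⟩
  rw [← hkt, show k = 1 by omega, pow_one]

theorem IsChordDart.not_isChordDart_rot (h2 : G.IsTwoConnected) (ho : P.IsOuterplane)
    (hdeg : ∀ v, G.degree v = 2 ∨ G.degree v = 3) {t : G.Dart} (ht : P.IsChordDart t) :
    ¬ P.IsChordDart (P.rot t) := by
  intro ht'
  obtain ⟨h3, o, ho₁, ho₂⟩ := ht.degree_eq_three ho hdeg
  obtain ⟨-, o', ho₁', ho₂'⟩ := ht'.degree_eq_three ho hdeg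
  have hoo : o' = o := by
    refine P.dart_eq_of_fst_eq h2 ?_ (ho₁'.trans ho₁.symm)
    rw [← P.rot_fst o', ho₂', P.rot_fst, ← ho₂, P.rot_fst]
  have hself : (P.rot ^ 1) t = t := by rw [pow_one, ← ho₂', hoo, ho₂]
  have := P.rot_pow_eq_self_iff.1 hself
  rw [h3] at this
  omega

/-- If the vertices of degree 3 alternate in color along the periphery, then two consecutive
chords on the boundary of a finite face have tails of the same color. -/
theorem color_eq_of_consecutive_chords (h2 : G.IsTwoConnected) (ho : P.IsOuterplane)
    (hdeg : ∀ v, G.degree v = 2 ∨ G.degree v = 3) (C : G.Coloring Bool)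
    (hC : ∀ (d : G.Dart) (n : ℕ), P.faceOf d = P.outerFace → 0 < n →
      G.degree d.fst = 3 → G.degree ((P.next ^ n) d).fst = 3 →
      (∀ m : ℕ, 0 < m → m < n → G.degree ((P.next ^ m) d).fst ≠ 3) →
      C d.fst ≠ C ((P.next ^ n) d).fst)
    {d : G.Dart} (hd : P.IsChordDart d) {n : ℕ} (hn : 0 < n)
    (hdn : P.IsChordDart ((P.next ^ n) d))
    (hbetween : ∀ m, 0 < m → m < n → ¬ P.IsChordDart ((P.next ^ m) d)) :
    C d.fst = C ((P.next ^ n) d).fst := by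
  have hsucc : ∀ m, (P.next ^ (m + 1)) d = P.rot ((P.next ^ m) d).symm := by
    intro m
    rw [pow_succ', Equiv.Perm.mul_apply, P.next_apply]
  -- Chords that follow each other directly would be two chords at one vertex of degree 3.
  have hn1 : n ≠ 1 := by
    rintro rfl
    exact hd.symm.not_isChordDart_rot h2 ho hdeg hdn
  have hout : ∀ m, 0 < m → m < n → P.faceOf ((P.next ^ m) d).symm = P.outerFace := by
    intro m hm hmn
    by_contra h
    refine hbetween m hm hmn ⟨?_, h⟩
    rw [P.faceOf_next_pow]
    exact hd.1
  have hdeg2 : ∀ m, 0 < m → m + 1 < n → G.degree ((P.next ^ m) d).snd = 2 := by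
    intro m hm hmn
    refine (hdeg _).resolve_right fun h3 => ?_
    refine hbetween (m + 1) (by omega) hmn ?_
    rw [hsucc]
    exact isChordDart_rot h2 (hout m hm (by omega)) h3
  -- The edges between the chords have the outer face on their other side; at vertices of degree 2
  -- the periphery retraces them backwards.
  have hback : ∀ m, 0 < m → m + 1 < n →
      P.next ((P.next ^ (m + 1)) d).symm = ((P.next ^ m) d).symm := by
    intro m hm hmn
    rw [P.next_apply, SimpleGraph.Dart.symm_symm, hsucc, ← Equiv.Perm.mul_apply, ← pow_two,
      P.rot_pow_eq_self_iff]
    rw [show G.degree ((P.next ^ m) d).symm.fst = 2 from hdeg2 m hm hmn]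
  have hpow : ∀ j, j + 1 < n →
      (P.next ^ j) ((P.next ^ (n - 1)) d).symm = ((P.next ^ (n - 1 - j)) d).symm := by
    intro j
    induction j with
    | zero => exact fun _ => rfl
    | succ j ih =>
      intro hj
      have h := hback (n - 1 - (j + 1)) (by omega) (by omega)
      rw [show n - 1 - (j + 1) + 1 = n - 1 - j by omega] at h
      rw [pow_succ', Equiv.Perm.mul_apply, ih (by omega), h]
  have hend : ((P.next ^ (n - 1)) ((P.next ^ (n - 1)) d).symm).fst = d.snd := by
    have h := hpow (n - 2) (by omega)
    have hx : ∀ x, (P.next ^ (n - 1)) x = P.next ((P.next ^ (n - 2)) x) := by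
      intro x
      rw [← Equiv.Perm.mul_apply, ← pow_succ', show n - 2 + 1 = n - 1 by omega]
    rw [hx, h, P.next_fst, show n - 1 - (n - 2) = 1 by omega, pow_one]
    exact P.next_fst d
  have hstart : ((P.next ^ (n - 1)) d).symm.fst = ((P.next ^ n) d).fst := by
    have h := P.next_pow_succ_fst d (n - 1)
    rw [show n - 1 + 1 = n by omega] at h
    exact h.symm
  -- The periphery runs from the tail of the second chord to the head of the first in `n - 1` steps,
  -- through vertices of degree 2. These ends differ in color, and so do head and tail of the first
  -- chord.
  have h := hC ((P.next ^ (n - 1)) d).symm (n - 1) (hout _ (by omega) (by omega)) (by omega)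
    (by rw [hstart]; exact (hdn.degree_eq_three ho hdeg).1)
    (by rw [hend]; exact (hd.symm.degree_eq_three ho hdeg).1)
    (by
      intro m hm hmn
      rw [hpow m (by omega)]
      have := hdeg2 (n - 1 - m) (by omega) (by omega)
      change G.degree ((P.next ^ (n - 1 - m)) d).snd ≠ 3
      omega)
  rw [hstart, hend] at h
  have hd' := C.valid d.adj
  revert h hd'
  cases C d.fst <;> cases C d.snd <;> cases C ((P.next ^ n) d).fst <;> simp

theorem color_eq_of_chords (h2 : G.IsTwoConnected) (ho : P.IsOuterplane)
    (hdeg : ∀ v, G.degree v = 2 ∨ G.degree v = 3) (C : G.Coloring Bool)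
    (hC : ∀ (d : G.Dart) (n : ℕ), P.faceOf d = P.outerFace → 0 < n →
      G.degree d.fst = 3 → G.degree ((P.next ^ n) d).fst = 3 →
      (∀ m : ℕ, 0 < m → m < n → G.degree ((P.next ^ m) d).fst ≠ 3) →
      C d.fst ≠ C ((P.next ^ n) d).fst)
    {d₁ d₂ : G.Dart} (h₁ : P.IsChordDart d₁) (h₂ : P.IsChordDart d₂)
    (hf : P.faceOf d₁ = P.faceOf d₂) : C d₁.fst = C d₂.fst := by
  classical
  obtain ⟨n, rfl⟩ := P.exists_next_pow_eq hf
  clear hf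
  induction n using Nat.strong_induction_on generalizing d₁ with
  | _ n ih =>
    rcases Nat.eq_zero_or_pos n with rfl | hn
    · rfl
    have hex : ∃ m, 0 < m ∧ P.IsChordDart ((P.next ^ m) d₁) := ⟨n, hn, h₂⟩
    obtain ⟨hk, hkd⟩ := Nat.find_spec hex
    have hkn : Nat.find hex ≤ n := Nat.find_min' hex ⟨hn, h₂⟩
    have hmin : ∀ m, 0 < m → m < Nat.find hex → ¬ P.IsChordDart ((P.next ^ m) d₁) :=
      fun m hm hmk h => Nat.find_min hex hmk ⟨hm, h⟩
    generalize Nat.find hex = k at *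
    have hsplit : (P.next ^ (n - k)) ((P.next ^ k) d₁) = (P.next ^ n) d₁ := by
      rw [← Equiv.Perm.mul_apply, ← pow_add, Nat.sub_add_cancel hkn]
    rw [color_eq_of_consecutive_chords h2 ho hdeg C hC h₁ hk hkd hmin,
      ih (n - k) (by omega) hkd (by rwa [hsplit]), hsplit]

/-- If the chords on the boundary of each finite face have tails of the same color, then the
vertices of degree 3 alternate in color along the periphery. -/
theorem color_ne_of_consecutive_degree_three (h2 : G.IsTwoConnected)
    (hdeg : ∀ v, G.degree v = 2 ∨ G.degree v = 3) (C : G.Coloring Bool)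
    (hC : ∀ d₁ d₂ : G.Dart, P.IsChordDart d₁ → P.IsChordDart d₂ →
      P.faceOf d₁ = P.faceOf d₂ → C d₁.fst = C d₂.fst)
    {d : G.Dart} {n : ℕ} (hd : P.faceOf d = P.outerFace) (hn : 0 < n)
    (h3 : G.degree d.fst = 3) (h3' : G.degree ((P.next ^ n) d).fst = 3)
    (hbetween : ∀ m : ℕ, 0 < m → m < n → G.degree ((P.next ^ m) d).fst ≠ 3) :
    C d.fst ≠ C ((P.next ^ n) d).fst := by
  have hsucc : ∀ m, (P.next ^ (m + 1)) d = P.rot ((P.next ^ m) d).symm := by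
    intro m
    rw [pow_succ', Equiv.Perm.mul_apply, P.next_apply]
  -- Passing a vertex of degree 2 does not change the face across the periphery.
  have hface : ∀ m < n, P.faceOf ((P.next ^ m) d).symm = P.faceOf d.symm := by
    intro m
    induction m with
    | zero => exact fun _ => rfl
    | succ m ih =>
      intro hm
      rw [← ih (by omega), ← P.faceOf_rot, hsucc, ← Equiv.Perm.mul_apply, ← pow_two,
        P.rot_pow_eq_self_iff.2]
      have h := (hdeg _).resolve_right (hbetween (m + 1) (by omega) hm)
      rw [P.next_pow_succ_fst] at h
      rw [show G.degree ((P.next ^ m) d).symm.fst = 2 from h]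
  obtain ⟨k, rfl⟩ : ∃ k, n = k + 1 := ⟨n - 1, by omega⟩
  have hchord := isChordDart_rot h2 hd h3
  have hchord' : P.IsChordDart (P.rot ((P.next ^ (k + 1)) d)) := by
    refine isChordDart_rot h2 ?_ h3'
    rw [P.faceOf_next_pow, hd]
  -- That face leaves by the chord at the start of the stretch and arrives by the chord at its end,
  -- so the latter is reversed: the start has the color of the neighbor of the end along its chord.
  have h := hC _ _ hchord'.symm hchord ?_
  · have hadj := C.valid (P.rot ((P.next ^ (k + 1)) d)).adj
    change C (P.rot ((P.next ^ (k + 1)) d)).snd = _ at h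
    rw [h, P.rot_fst, P.rot_fst] at hadj
    exact hadj.symm
  · rw [← P.faceOf_rot, P.faceOf_rot d, ← hface k (by omega), hsucc, ← Equiv.Perm.mul_apply,
      ← Equiv.Perm.mul_apply, ← pow_two, ← pow_succ, P.rot_pow_eq_self_iff.2]
    rw [P.next_pow_succ_fst] at h3'
    rw [show G.degree ((P.next ^ k) d).symm.fst = 3 from h3']

/-- At a vertex of degree at least 4 two chords are neighbors in the rotation. One of them reversed
and the other lie on a common face, and their tails are adjacent. -/
theorem degree_le_three (h2 : G.IsTwoConnected) (ho : P.IsOuterplane) (C : G.Coloring Bool)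
    (hC : ∀ d₁ d₂ : G.Dart, P.IsChordDart d₁ → P.IsChordDart d₂ →
      P.faceOf d₁ = P.faceOf d₂ → C d₁.fst = C d₂.fst) (v : V) : G.degree v ≤ 3 := by
  obtain ⟨o, rfl, ho'⟩ := exists_outer_dart ho v
  by_contra hlt
  have h₁ := isChordDart_rot_pow h2 ho' (k := 1) (by omega) (by omega)
  have h₂ := isChordDart_rot_pow h2 ho' (k := 2) (by omega) (by omega)
  have h := hC _ _ h₁.symm h₂ (by
    rw [← P.faceOf_rot, ← Equiv.Perm.mul_apply, ← pow_succ'])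
  have hadj := C.valid ((P.rot ^ 1) o).adj
  change C ((P.rot ^ 1) o).snd = _ at h
  rw [h, P.rot_pow_fst, P.rot_pow_fst] at hadj
  exact hadj rfl

end Degree

end PlaneEmbedding

/-! ### The equivalence -/

theorem lemma3p3 {V : Type*} [Fintype V] (G : SimpleGraph V) [DecidableRel G.Adj]
    (P : PlaneEmbedding G) (hconn : G.IsTwoConnected) (houter : P.IsOuterplane)
    (hbip : G.IsBipartite) :
    P.IsPeripherallyTwoColorable ↔ ¬ P.HasLinearlyConnectedTriple := by
  constructor
  · rintro ⟨-, -, -, hdeg, -, C, hC⟩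
    rw [PlaneEmbedding.not_hasLinearlyConnectedTriple_iff hconn houter C]
    exact fun d₁ d₂ => PlaneEmbedding.color_eq_of_chords hconn houter hdeg C hC
  · intro h
    obtain ⟨C₀⟩ := hbip
    let C : G.Coloring Bool := G.recolorOfEquiv finTwoEquiv C₀
    rw [PlaneEmbedding.not_hasLinearlyConnectedTriple_iff hconn houter C] at h
    have hdeg : ∀ v, G.degree v = 2 ∨ G.degree v = 3 := by
      intro v
      have h₁ := PlaneEmbedding.two_le_degree hconn houter v
      have h₂ := PlaneEmbedding.degree_le_three hconn houter C h v
      omega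
    refine ⟨⟨C₀⟩, PlaneEmbedding.isElementary_of_isOuterplane hconn houter C, ?_, hdeg,
      fun v _ => houter v, C, fun d n hd hn h3 h3' hbetween =>
        PlaneEmbedding.color_ne_of_consecutive_degree_three hconn hdeg C h hd hn h3 h3' hbetween⟩
    rintro ⟨e⟩
    have hcard := Nat.card_congr e.toEquiv
    rw [Nat.card_fin] at hcard
    have := hconn.1
    omega
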